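/- Let $\mathbb F_q$ be the finite field with $q$ elements and let $K$ be a global function field over $\mathbb F_q$, that is, a finite extension of the rational function field $\mathbb F_q(T)$. Fix a place $\mathfrak p_\infty$ of $K$, and let $A$ be the ring of all $x\in K$ with $v_{\mathfrak p}(x)\ge 0$ for every place $\mathfrak p\ne\mathfrak p_\infty$ of $K$. Let $E$ be a finite extension of $K$, and let $E\langle\tau\rangle$ be the ring of twisted polynomials over $E$, in which $\tau c=c^q\tau$ for $c\in E$. Let $\rho\colon A\to E\langle\tau\rangle$, $a\mapsto\rho_a$, be an $A$-Drinfeld module over $E$ of generic characteristic and of arbitrary rank, that is, an $\mathbb F_q$-algebra homomorphism such that the constant term of $\rho_a$ is $a$ for every $a\in A$, and such that $\rho_a\neq a$ for at least one $a\in A$. Let $L/E$ be a finite extension (not necessarily separable), regarded as an $A$-module through $a\cdot u=\rho_a(u)$, where $\sum_i c_i\tau^i$ acts on $L$ by $u\mapsto\sum_i c_iu^{q^i}$. Let $$\operatorname{DrinT}(L/E)=\{u\in L\mid \rho_m(u)\in E\text{ for some } m\in A\setminus\{0\}\},$$ which is an $A$-submodule of $L$ containing $E$. Then the Drinfeld cogalois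 module $\operatorname{DrinT}(L/E)/E$ is finite, i.e. it has only finitely many elements. -/

import Mathlib

/-- A place of a function field `K` with constants `F`: a valuation ring of `K` containing the
constants and different from `K` itself. -/
@[ext]
structure FunctionFieldPlace (F K : Type*) [Field F] [Field K] [Algebra F K] where
  toValuationSubring : ValuationSubring K
  algebraMap_mem : ∀ c : F, algebraMap F K c ∈ toValuationSubring
  ne_top : toValuationSubring ≠ ⊤

/-- The ring `A` of elements of `K` that are integral at every place other than `P∞`. -/
def FunctionFieldPlace.regularAway {F K : Type*} [Field F] [Field K] [Algebra F K]
    (Pinf : FunctionFieldPlace F K) : Subalgebra F K where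
  carrier := {x | ∀ P : FunctionFieldPlace F K, P ≠ Pinf → x ∈ P.toValuationSubring}
  mul_mem' hx hy P hP := P.toValuationSubring.mul_mem _ _ (hx P hP) (hy P hP)
  add_mem' hx hy P hP := P.toValuationSubring.add_mem _ _ (hx P hP) (hy P hP)
  algebraMap_mem' c P _ := P.algebraMap_mem c

/-- The action of `ℕ` on an `Fq`-algebra `E` through powers of the `q`-Frobenius `x ↦ x ^ q`. -/
@[reducible]
noncomputable def frobeniusAction (Fq E : Type*) [Field Fq] [Fintype Fq] [Field E]
    [Algebra Fq E] : MulSemiringAction (Multiplicative ℕ) E where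
  smul n x := x ^ Fintype.card Fq ^ n.toAdd
  one_smul x := by
    change x ^ Fintype.card Fq ^ 0 = x
    simp
  mul_smul m n x := by
    change x ^ Fintype.card Fq ^ (m.toAdd + n.toAdd) =
      (x ^ Fintype.card Fq ^ n.toAdd) ^ Fintype.card Fq ^ m.toAdd
    rw [← pow_mul, ← pow_add, add_comm]
  smul_zero n := by
    change (0 : E) ^ Fintype.card Fq ^ n.toAdd = 0
    exact zero_pow (pow_ne_zero _ Fintype.card_ne_zero)
  smul_add n x y := by
    change (x + y) ^ Fintype.card Fq ^ n.toAdd =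
      x ^ Fintype.card Fq ^ n.toAdd + y ^ Fintype.card Fq ^ n.toAdd
    have h : ∀ z : E, z ^ Fintype.card Fq ^ n.toAdd =
        (FiniteField.frobeniusAlgHom Fq E ^ n.toAdd) z := by
      intro z
      rw [AlgHom.coe_pow, FiniteField.coe_frobeniusAlgHom, pow_iterate]
    rw [h, h, h, map_add]
  smul_one n := by
    change (1 : E) ^ Fintype.card Fq ^ n.toAdd = 1
    exact one_pow _
  smul_mul n x y := by
    change (x * y) ^ Fintype.card Fq ^ n.toAdd =
      x ^ Fintype.card Fq ^ n.toAdd * y ^ Fintype.card Fq ^ n.toAdd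
    exact mul_pow _ _ _

/-- The ring `E⟨τ⟩` of twisted polynomials `∑ cᵢ τ ^ i`, with `τ * c = c ^ q * τ`, where
`q = |Fq|`. -/
def TwistedPolynomial (Fq E : Type*) [Field Fq] [Fintype Fq] [Field E] [Algebra Fq E] : Type _ :=
  SkewPolynomial E

namespace TwistedPolynomial

section

variable (Fq E : Type*) [Field Fq] [Fintype Fq] [Field E] [Algebra Fq E]

noncomputable instance : Ring (TwistedPolynomial Fq E) :=
  letI := frobeniusAction Fq E
  inferInstanceAs (Ring (SkewPolynomial E))

end

variable {Fq E : Type*} [Field Fq] [Fintype Fq] [Field E] [Algebra Fq E]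

/-- The coefficient of `τ ^ i`. -/
def coeff (f : TwistedPolynomial Fq E) (i : ℕ) : E :=
  SkewPolynomial.coeff f i

/-- The finite set of `i` such that the coefficient of `τ ^ i` is nonzero. -/
def support (f : TwistedPolynomial Fq E) : Finset ℕ :=
  SkewPolynomial.support f

/-- The twisted polynomial `c τ ^ i`. -/
noncomputable def monomial (i : ℕ) (c : E) : TwistedPolynomial Fq E :=
  SkewPolynomial.monomial i c

theorem ext_coeff {f g : TwistedPolynomial Fq E} (h : ∀ i, f.coeff i = g.coeff i) : f = g :=
  SkewPolynomial.ext h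

theorem coeff_monomial (i j : ℕ) (c : E) :
    (monomial i c : TwistedPolynomial Fq E).coeff j = if i = j then c else 0 :=
  SkewPolynomial.coeff_monomial

theorem coeff_add (f g : TwistedPolynomial Fq E) (i : ℕ) :
    (f + g).coeff i = f.coeff i + g.coeff i :=
  congrFun (congrArg DFunLike.coe (SkewMonoidAlgebra.coeff_add f g)) (Multiplicative.ofAdd i)

theorem mem_support_iff (f : TwistedPolynomial Fq E) (i : ℕ) :
    i ∈ f.support ↔ f.coeff i ≠ 0 :=
  SkewPolynomial.mem_support_iff

theorem monomial_mul_monomial (i j : ℕ) (c d : E) :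
    (monomial i c * monomial j d : TwistedPolynomial Fq E) =
      monomial (i + j) (c * d ^ Fintype.card Fq ^ i) := by
  let _ := frobeniusAction Fq E
  have h := SkewPolynomial.monomial_mul_monomial i j c d
  rw [SkewPolynomial.φ_iterate_apply] at h
  exact h

theorem one_eq : (1 : TwistedPolynomial Fq E) = monomial 0 1 :=
  rfl

theorem induction_on {motive : TwistedPolynomial Fq E → Prop} (f : TwistedPolynomial Fq E)
    (h0 : motive 0) (hadd : ∀ f g, motive f → motive g → motive (f + g))
    (hmon : ∀ i c, motive (monomial i c)) : motive f := by
  refine SkewPolynomial.induction (motive := motive) f h0 ?_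
  intro i c g _ _ hg
  exact hadd _ _ (hmon i c) hg

theorem monomial_add (i : ℕ) (c d : E) :
    (monomial i (c + d) : TwistedPolynomial Fq E) = monomial i c + monomial i d :=
  SkewPolynomial.monomial_add i c d

theorem monomial_zero_right (i : ℕ) : (monomial i 0 : TwistedPolynomial Fq E) = 0 :=
  SkewPolynomial.monomial_zero_right i

theorem commute_constant (c : Fq) (f : TwistedPolynomial Fq E) :
    monomial 0 (algebraMap Fq E c) * f = f * monomial 0 (algebraMap Fq E c) := by
  induction f using induction_on with
  | h0 => rw [mul_zero, zero_mul]
  | hadd f g hf hg => rw [mul_add, add_mul, hf, hg]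
  | hmon i d =>
    rw [monomial_mul_monomial, monomial_mul_monomial, pow_zero, pow_one, ← map_pow,
      FiniteField.pow_card_pow, zero_add, add_zero, mul_comm]

variable (Fq E) in
/-- The constants of `E⟨τ⟩` in `Fq`. -/
noncomputable def constantHom : Fq →+* TwistedPolynomial Fq E where
  toFun c := monomial 0 (algebraMap Fq E c)
  map_one' := by rw [map_one, one_eq]
  map_mul' c d := by
    rw [monomial_mul_monomial, pow_zero, pow_one, map_mul]
  map_zero' := by rw [map_zero, monomial_zero_right]
  map_add' c d := by rw [map_add, monomial_add]

noncomputable instance : Algebra Fq (TwistedPolynomial Fq E) :=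
  (constantHom Fq E).toAlgebra' commute_constant

theorem algebraMap_eq (c : Fq) :
    algebraMap Fq (TwistedPolynomial Fq E) c = monomial 0 (algebraMap Fq E c) :=
  rfl

section Action

variable (L : Type*) [Field L] [Algebra Fq L] [Algebra E L]

/-- `c τ ^ i` as the additive map `u ↦ c u ^ (q ^ i)` of an extension `L` of `E`. -/
noncomputable def monomialEnd (i : ℕ) : E →+ AddMonoid.End L where
  toFun c :=
    { toFun := fun u => algebraMap E L c * u ^ Fintype.card Fq ^ i
      map_zero' := by
        rw [zero_pow (pow_ne_zero _ Fintype.card_ne_zero), mul_zero]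
      map_add' := fun u v => by
        have h := (frobeniusAction Fq L).smul_add (Multiplicative.ofAdd i) u v
        change (u + v) ^ Fintype.card Fq ^ i =
          u ^ Fintype.card Fq ^ i + v ^ Fintype.card Fq ^ i at h
        rw [h, mul_add] }
  map_zero' := by
    ext u
    change algebraMap E L 0 * u ^ Fintype.card Fq ^ i = 0
    rw [map_zero, zero_mul]
  map_add' c d := by
    ext u
    change algebraMap E L (c + d) * u ^ Fintype.card Fq ^ i =
      algebraMap E L c * u ^ Fintype.card Fq ^ i + algebraMap E L d * u ^ Fintype.card Fq ^ i
    rw [map_add, add_mul]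

/-- The action of `∑ cᵢ τ ^ i` on an extension `L` of `E`, as an additive map in the twisted
polynomial. -/
noncomputable def toEndAddHom : TwistedPolynomial Fq E →+ AddMonoid.End L where
  toFun f := SkewPolynomial.sum f fun i c => monomialEnd (Fq := Fq) L i c
  map_zero' := SkewPolynomial.sum_zero_index _
  map_add' f g := SkewPolynomial.sum_add_index f g _ (fun _ => map_zero _)
    (fun _ c d => map_add _ c d)

theorem toEndAddHom_monomial (i : ℕ) (c : E) :
    toEndAddHom L (monomial i c : TwistedPolynomial Fq E) = monomialEnd (Fq := Fq) L i c :=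
  SkewPolynomial.sum_monomial_index (h := fun i c => monomialEnd (Fq := Fq) L i c)
    (map_zero _)

theorem toEndAddHom_mul (f g : TwistedPolynomial Fq E) :
    toEndAddHom L (f * g) = toEndAddHom L f * toEndAddHom L g := by
  induction f using induction_on with
  | h0 => rw [zero_mul, map_zero, zero_mul]
  | hadd f₁ f₂ h₁ h₂ => rw [add_mul, map_add, h₁, h₂, map_add, add_mul]
  | hmon i c =>
    induction g using induction_on with
    | h0 => rw [mul_zero, map_zero, mul_zero]
    | hadd g₁ g₂ h₁ h₂ => rw [mul_add, map_add, h₁, h₂, map_add, mul_add]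
    | hmon j d =>
      rw [monomial_mul_monomial, toEndAddHom_monomial, toEndAddHom_monomial,
        toEndAddHom_monomial]
      ext u
      change algebraMap E L (c * d ^ Fintype.card Fq ^ i) * u ^ Fintype.card Fq ^ (i + j) =
        algebraMap E L c * (algebraMap E L d * u ^ Fintype.card Fq ^ j) ^ Fintype.card Fq ^ i
      rw [map_mul, map_pow, mul_pow, ← pow_mul, ← pow_add, add_comm j i, mul_assoc]

/-- The action of twisted polynomials on an extension `L` of `E`: `∑ cᵢ τ ^ i` acts as
`u ↦ ∑ cᵢ u ^ (q ^ i)`. -/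
noncomputable def toEnd : TwistedPolynomial Fq E →+* AddMonoid.End L :=
  { toEndAddHom L with
    map_one' := by
      change toEndAddHom L (1 : TwistedPolynomial Fq E) = 1
      rw [one_eq, toEndAddHom_monomial]
      ext u
      change algebraMap E L 1 * u ^ Fintype.card Fq ^ 0 = u
      rw [map_one, one_mul, pow_zero, pow_one]
    map_mul' := toEndAddHom_mul L }

theorem toEnd_apply (f : TwistedPolynomial Fq E) (u : L) :
    toEnd L f u = ∑ i ∈ f.support,
      algebraMap E L (f.coeff i) * u ^ Fintype.card Fq ^ i := by
  change (SkewPolynomial.sum f fun i c => monomialEnd (Fq := Fq) L i c) u = _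
  have h : (SkewPolynomial.sum f fun i c => monomialEnd (Fq := Fq) L i c) =
      ∑ i ∈ f.support, monomialEnd (Fq := Fq) L i (f.coeff i) :=
    SkewPolynomial.sum_def f _
  rw [h]
  exact AddMonoidHom.finsetSum_apply _ _ _

end Action

end TwistedPolynomial

/-- An `A`-Drinfeld module over `E` (of arbitrary rank), where `E` is an `A`-algebra with structure
map `δ = algebraMap A E`: an `Fq`-algebra homomorphism `ρ : A → E⟨τ⟩` such that the constant term
of `ρ_a` is `δ a`, and which is not the trivial homomorphism `a ↦ δ a`. -/
structure DrinfeldModule (Fq A E : Type*) [Field Fq] [Fintype Fq] [CommRing A] [Algebra Fq A]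
    [Field E] [Algebra Fq E] [Algebra A E] where
  toAlgHom : A →ₐ[Fq] TwistedPolynomial Fq E
  coeff_zero : ∀ a, (toAlgHom a).coeff 0 = algebraMap A E a
  nontrivial : ∃ a, toAlgHom a ≠ TwistedPolynomial.monomial 0 (algebraMap A E a)

namespace DrinfeldModule

variable {Fq A E : Type*} [Field Fq] [Fintype Fq] [CommRing A] [Algebra Fq A]
  [Field E] [Algebra Fq E] [Algebra A E]

/-- The additive group of an extension `L` of `E`, to be regarded as an `A`-module through `ρ`. -/
@[nolint unusedArguments]
def Points (_ρ : DrinfeldModule Fq A E) (L : Type*) : Type _ := L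

variable (ρ : DrinfeldModule Fq A E) (L : Type*) [Field L] [Algebra Fq L] [Algebra E L]

instance : AddCommGroup (ρ.Points L) :=
  inferInstanceAs (AddCommGroup L)

/-- The `A`-module structure on `L` given by `a • u = ρ_a(u)`. -/
noncomputable instance : Module A (ρ.Points L) :=
  Module.compHom L ((TwistedPolynomial.toEnd (Fq := Fq) (E := E) L).comp
    (ρ.toAlgHom : A →+* TwistedPolynomial Fq E))

/-- The identity map from `L` to `L` regarded as an `A`-module. -/
def Points.of : L ≃+ ρ.Points L :=
  AddEquiv.refl L

theorem smul_of (a : A) (u : L) :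
    a • Points.of ρ L u = Points.of ρ L (TwistedPolynomial.toEnd L (ρ.toAlgHom a) u) :=
  rfl

/-- The base field `E` as an `A`-submodule of `L`. -/
def base : Submodule A (ρ.Points L) where
  carrier := {u | ∃ x : E, Points.of ρ L (algebraMap E L x) = u}
  zero_mem' := ⟨0, by rw [map_zero, map_zero]⟩
  add_mem' := by
    rintro _ _ ⟨x, rfl⟩ ⟨y, rfl⟩
    exact ⟨x + y, by rw [map_add, map_add]⟩
  smul_mem' := by
    rintro a _ ⟨x, rfl⟩
    refine ⟨TwistedPolynomial.toEnd E (ρ.toAlgHom a) x, ?_⟩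
    rw [smul_of, TwistedPolynomial.toEnd_apply, TwistedPolynomial.toEnd_apply, map_sum]
    simp only [map_mul, map_pow, Algebra.algebraMap_self, RingHom.id_apply]

variable [IsDomain A]

/-- `DrinT(L/E)`: the elements `u` of `L` such that `ρ_m(u) ∈ E` for some nonzero `m ∈ A`. -/
def drinT : Submodule A (ρ.Points L) where
  carrier := {u | ∃ m : A, m ≠ 0 ∧ m • u ∈ ρ.base L}
  zero_mem' := ⟨1, one_ne_zero, by rw [smul_zero]; exact zero_mem _⟩
  add_mem' := by
    rintro u v ⟨m, hm, hu⟩ ⟨n, hn, hv⟩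
    refine ⟨m * n, mul_ne_zero hm hn, ?_⟩
    rw [smul_add]
    refine add_mem ?_ ?_
    · rw [mul_comm, mul_smul]
      exact Submodule.smul_mem _ _ hu
    · rw [mul_smul]
      exact Submodule.smul_mem _ _ hv
  smul_mem' := by
    rintro a u ⟨m, hm, hu⟩
    refine ⟨m, hm, ?_⟩
    rw [smul_comm]
    exact Submodule.smul_mem _ _ hu

/-- The Drinfeld cogalois module `DrinT(L/E)/E`. -/
abbrev CogaloisModule : Type _ :=
  ρ.drinT L ⧸ (ρ.base L).submoduleOf (ρ.drinT L)

end DrinfeldModule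

/-! Let `Ω` be an algebraic closure of `L`. If `ρ_m(u) ∈ E`, then for any two `E`-embeddings `σ, τ :
L → Ω` the difference `σ u - τ u` is an `m`-torsion point of the normal closure `N` of `L/E` in `Ω`.
There are finitely many pairs `(σ, τ)`, and `N/E` is finite, so if `N` has finitely many torsion
points, only finitely many families of differences occur. Two elements of `DrinT(L/E)` with the same
family differ by some `w` fixed by all embeddings. This `w` is a root of `ρ_{m'}(X) - e`, whose
derivative is the nonzero constant `m'`. Hence `w` is separable over `E` and lies in `E`
(`IsSeparable.mem_range_of_algHom_eq`), even when `L/E` is inseparable.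

Finiteness of torsion (`finite_setOf_torsion`) is a Northcott argument without heights. Fix `a` with
`ρ_a` of degree at least `2`; every torsion point is killed by some nonzero `P(a)` with `P` over
`Fq`, so its orbit under `ρ_a` is finite. Points of finite orbit have poles bounded uniformly at all
places, and a global function field contains finitely many of these
(`FunctionField.finite_setOf_finite_orbit`). -/

/-! ### Escape to infinity, and denominators of points with finite orbit -/

-- Beyond the radius `v B` the leading term strictly dominates, and degree at least `2` makes it
-- exceed `x` itself.
open Polynomial in
theorem Valuation.lt_eval_of_lt {N Γ : Type*} [Field N] [LinearOrderedCommGroupWithZero Γ]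
    (v : Valuation N Γ) {f : N[X]} (hf : 2 ≤ f.natDegree) {B : N} (hB : 1 ≤ v B)
    (hlead : 1 ≤ v f.leadingCoeff * v B)
    (hcoeff : ∀ i < f.natDegree, v (f.coeff i) ≤ v f.leadingCoeff * v B)
    {x : N} (hx : v B < v x) : v x < v (f.eval x) := by
  have hx1 : 1 < v x := hB.trans_lt hx
  have hx0 : 0 < v x := zero_lt_one.trans hx1
  have hl : 0 < v f.leadingCoeff := by
    rw [zero_lt_iff]
    rintro h
    rw [h, zero_mul] at hlead
    exact absurd hlead (not_le.2 zero_lt_one)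
  have hlower : v (∑ i ∈ Finset.range f.natDegree, f.coeff i * x ^ i) <
      v (f.leadingCoeff * x ^ f.natDegree) := by
    have hpos : 0 < v (f.leadingCoeff * x ^ f.natDegree) := by
      rw [map_mul, map_pow]
      exact mul_pos hl (pow_pos hx0 _)
    refine v.map_sum_lt hpos.ne' fun i hi => ?_
    rw [Finset.mem_range] at hi
    calc v (f.coeff i * x ^ i) = v (f.coeff i) * v x ^ i := by rw [map_mul, map_pow]
      _ ≤ v f.leadingCoeff * v B * v x ^ i := mul_le_mul_left (hcoeff i hi) _
      _ < v f.leadingCoeff * v x * v x ^ i :=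
        mul_lt_mul_of_pos_right (mul_lt_mul_of_pos_left hx hl) (pow_pos hx0 _)
      _ = v f.leadingCoeff * v x ^ (i + 1) := by rw [pow_succ', mul_assoc]
      _ ≤ v f.leadingCoeff * v x ^ f.natDegree :=
        mul_le_mul_right (pow_le_pow_right₀ hx1.le hi) _
      _ = v (f.leadingCoeff * x ^ f.natDegree) := by rw [map_mul, map_pow]
  rw [eval_eq_sum_range, Finset.sum_range_succ, coeff_natDegree, v.map_add_eq_of_lt_right hlower,
    map_mul, map_pow]
  calc v x = 1 * v x := (one_mul _).symm
    _ ≤ v f.leadingCoeff * v B * v x := mul_le_mul_left hlead _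
    _ < v f.leadingCoeff * v x * v x :=
        mul_lt_mul_of_pos_right (mul_lt_mul_of_pos_left hx hl) hx0
    _ = v f.leadingCoeff * v x ^ 2 := by rw [pow_two, mul_assoc]
    _ ≤ v f.leadingCoeff * v x ^ f.natDegree :=
        mul_le_mul_right (pow_le_pow_right₀ hx1.le hf) _

/-- An element of a field is integral over a ring iff it lies in every valuation subring that
contains the image of the ring. -/
theorem isIntegral_iff_forall_mem_valuationSubring (R : Type*) {N : Type*} [CommRing R] [Field N]
    [Algebra R N] {z : N} :
    IsIntegral R z ↔ ∀ V : ValuationSubring N, Set.range (algebraMap R N) ⊆ V → z ∈ V := by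
  have hz : z ∈ (⨅ V : {V : ValuationSubring N // Set.range (algebraMap R N) ⊆ V.toSubring},
      V.1.toSubring) ↔ IsIntegral (algebraMap R N).range z := by
    rw [iInf_valuationSubring_superset, ← RingHom.coe_range, Subring.closure_eq]
    rfl
  -- A monic polynomial over the image of `R` lifts to a monic polynomial over `R`.
  have hR : IsIntegral (algebraMap R N).range z ↔ IsIntegral R z := by
    constructor
    · rintro ⟨p, hp, hpz⟩
      obtain ⟨r, hr, -, hrm⟩ := Polynomial.lifts_and_natDegree_eq_and_monic
        (Polynomial.map_surjective _ (algebraMap R N).rangeRestrict_surjective p) hp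
      refine ⟨r, hrm, ?_⟩
      rw [← hr, Polynomial.eval₂_map] at hpz
      exact hpz
    · rintro ⟨p, hp, hpz⟩
      refine ⟨p.map (algebraMap R N).rangeRestrict, hp.map _, ?_⟩
      rw [Polynomial.eval₂_map]
      exact hpz
  rw [← hR, ← hz, Subring.mem_iInf]
  exact ⟨fun h V hV => h ⟨V, hV⟩, fun h V => h V.1 V.2⟩

open Polynomial in
/-- The points with finite orbit under a polynomial of degree at least `2` have a common
denominator. -/
theorem Polynomial.exists_isIntegral_smul_of_finite_orbit (R : Type*) {N : Type*} [CommRing R]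
    [IsDomain R] [Field N] [Algebra R N] [FaithfulSMul R N] [Algebra.IsAlgebraic R N] {f : N[X]}
    (hf : 2 ≤ f.natDegree) :
    ∃ D : R, D ≠ 0 ∧ ∀ x : N,
      (Set.range fun n : ℕ => (fun y => f.eval y)^[n] x).Finite → IsIntegral R (D • x) := by
  classical
  have hl : f.leadingCoeff ≠ 0 := by
    rw [Ne, leadingCoeff_eq_zero]
    rintro rfl
    simp at hf
  -- With leading coefficient `l`, integrality of `D / l` and `D cᵢ / l` gives the hypotheses of
  -- `Valuation.lt_eval_of_lt` for `B = D⁻¹` at every `V` containing `R` simultaneously.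
  obtain ⟨D, hD, hint⟩ := Algebra.IsAlgebraic.exists_integral_multiples R
    (insert f.leadingCoeff⁻¹
      ((Finset.range f.natDegree).image fun i => f.leadingCoeff⁻¹ * f.coeff i))
  refine ⟨D, hD, fun x hx => ?_⟩
  have hDN : algebraMap R N D ≠ 0 := by
    rwa [Ne, FaithfulSMul.algebraMap_eq_zero_iff]
  refine (isIntegral_iff_forall_mem_valuationSubring R).2 fun V hV => ?_
  have hVint : ∀ z, IsIntegral R z → V.valuation z ≤ 1 := by
    intro z hz
    exact (V.valuation_le_one_iff z).2 ((isIntegral_iff_forall_mem_valuationSubring R).1 hz V hV)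
  by_contra hcon
  rw [← V.valuation_le_one_iff, not_le, Algebra.smul_def, map_mul] at hcon
  have hvD : 0 < V.valuation (algebraMap R N D) := by
    rwa [zero_lt_iff, Valuation.ne_zero_iff]
  have hvl : 0 < V.valuation f.leadingCoeff := by
    rwa [zero_lt_iff, Valuation.ne_zero_iff]
  have key : ∀ y, V.valuation (algebraMap R N D)⁻¹ < V.valuation y →
      V.valuation y < V.valuation (f.eval y) := by
    refine fun y => Valuation.lt_eval_of_lt _ hf ?_ ?_ ?_
    · rw [map_inv₀, one_le_inv₀ hvD]
      exact (V.valuation_le_one_iff _).2 (hV ⟨D, rfl⟩)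
    · have := hVint _ (hint _ (Finset.mem_insert_self _ _))
      rw [Algebra.smul_def, map_mul, map_inv₀] at this
      rw [map_inv₀, ← div_eq_mul_inv, one_le_div₀ hvD]
      rwa [← div_eq_mul_inv, div_le_one₀ hvl] at this
    · intro i hi
      have := hVint _ (hint _ (Finset.mem_insert_of_mem
        (Finset.mem_image_of_mem _ (Finset.mem_range.2 hi))))
      rw [Algebra.smul_def, map_mul, map_mul, map_inv₀] at this
      rw [map_inv₀, ← div_eq_mul_inv, le_div_iff₀ hvD]
      rwa [mul_comm, mul_assoc, inv_mul_le_iff₀ hvl, mul_one] at this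
  have hlt : ∀ n : ℕ, V.valuation (algebraMap R N D)⁻¹ <
      V.valuation ((fun y => f.eval y)^[n] x) := by
    intro n
    induction n with
    | zero =>
      rw [map_inv₀, inv_lt_iff_one_lt_mul₀ hvD, mul_comm]
      simpa using hcon
    | succ n ih =>
      rw [Function.iterate_succ_apply']
      exact ih.trans (key _ ih)
  -- If `D x ∉ V`, the valuations along the orbit increase strictly, so the orbit is infinite.
  have hmono : StrictMono fun n : ℕ => V.valuation ((fun y => f.eval y)^[n] x) := by
    refine strictMono_nat_of_lt_succ fun n => ?_
    rw [Function.iterate_succ_apply']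
    exact key _ (hlt n)
  refine Set.infinite_range_of_injective (f := fun n : ℕ => (fun y => f.eval y)^[n] x) ?_ hx
  exact fun a b h => hmono.injective (congrArg V.valuation h)

/-! ### Northcott finiteness in global function fields -/

/-- With `n` the degree of `x`, scaling `x` by `D` multiplies the `j`-th coefficient by `D ^ (n -
j)`, and the result lies in `R` because `D • x` is integral over the integrally closed `R`. The
fixed exponent `m` makes the denominator independent of `x` and `j`. -/
theorem minpoly.pow_mul_coeff_mem_range {R F N : Type*} [CommRing R] [IsDomain R]
    [IsIntegrallyClosed R] [Field F] [Algebra R F] [IsFractionRing R F] [Field N] [Algebra F N]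
    [Algebra R N] [IsScalarTower R F N] [Algebra.IsAlgebraic F N] {D : R} (hD : D ≠ 0) {x : N}
    (hx : IsIntegral R (D • x)) {m : ℕ} (hm : (minpoly F x).natDegree ≤ m) (j : ℕ) :
    algebraMap R F D ^ m * (minpoly F x).coeff j ∈ (algebraMap R F).range := by
  have hDF : algebraMap R F D ≠ 0 := by
    rwa [Ne, FaithfulSMul.algebraMap_eq_zero_iff]
  have h := IsIntegrallyClosed.minpoly_smul hDF (Algebra.IsIntegral.isIntegral (R := F) x)
  rw [algebraMap_smul, minpoly.isIntegrallyClosed_eq_field_fractions' F hx] at h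
  have hj := congrArg (Polynomial.coeff · j) h
  simp only [Polynomial.coeff_map, Polynomial.coeff_scaleRoots] at hj
  refine ⟨D ^ (m - ((minpoly F x).natDegree - j)) * (minpoly R (D • x)).coeff j, ?_⟩
  rw [map_mul, map_pow, hj, mul_left_comm, ← pow_add,
    Nat.sub_add_cancel ((Nat.sub_le _ _).trans hm), mul_comm]

-- For `c ≠ 0`, `deg (a c) = deg (a / b) + deg (b c) ≤ deg (a / b)`, and over a finite field there
-- are finitely many polynomials of bounded degree.
open Polynomial in
theorem RatFunc.finite_setOf_mul_mem {k : Type*} [Field k] [Finite k]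
    [DecidableEq (RatFunc k)] {a b : RatFunc k} (ha : a ≠ 0) (hb : b ≠ 0) :
    {c : RatFunc k | a * c ∈ (algebraMap k[X] (RatFunc k)).range ∧
      b * c ∈ (RatFunc.inftyValuation k).valuationSubring}.Finite := by
  have hfin : (algebraMap k[X] (RatFunc k) ''
      (degreeLE k ((a / b).intDegree.toNat : ℕ) : Set k[X])).Finite := by
    have : Finite (degreeLT k ((a / b).intDegree.toNat + 1)) :=
      Finite.of_equiv _ (degreeLTEquiv k _).symm.toEquiv
    rw [← degreeLT_succ_eq_degreeLE]
    exact (Set.toFinite _).image _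
  refine (hfin.image (a⁻¹ * ·)).subset ?_
  rintro c ⟨⟨p, hp⟩, hc⟩
  refine ⟨a * c, ⟨p, ?_, hp⟩, inv_mul_cancel_left₀ ha c⟩
  rw [SetLike.mem_coe, mem_degreeLE, ← natDegree_le_iff_degree_le]
  by_cases hp0 : p = 0
  · simp [hp0]
  have hc0 : c ≠ 0 := by
    rintro rfl
    rw [mul_zero] at hp
    exact hp0 ((FaithfulSMul.algebraMap_eq_zero_iff _ _).1 hp)
  have hdeg : (b * c).intDegree ≤ 0 := by
    rw [Valuation.mem_valuationSubring_iff, RatFunc.inftyValuation_apply,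
      RatFunc.inftyValuation_of_nonzero k (mul_ne_zero hb hc0), ← WithZero.exp_zero,
      WithZero.exp_le_exp] at hc
    exact hc
  have hdp : (p.natDegree : ℤ) = (a * c).intDegree := by rw [← hp, RatFunc.intDegree_polynomial]
  rw [RatFunc.intDegree_mul ha hc0] at hdp
  rw [RatFunc.intDegree_mul hb hc0] at hdeg
  rw [RatFunc.intDegree_div ha hb]
  omega

theorem minpoly.finite_of_coeff_mem {F N : Type*} [Field F] [Field N] [Algebra F N]
    [Algebra.IsAlgebraic F N] {S : Set F} (hS : S.Finite) (m : ℕ) :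
    {x : N | (minpoly F x).natDegree ≤ m ∧ ∀ j, (minpoly F x).coeff j ∈ S}.Finite := by
  have : Finite S := hS
  have hfin : Set.Finite {p : Polynomial F | p.natDegree ≤ m ∧ ∀ j, p.coeff j ∈ S} := by
    refine Set.Finite.of_finite_image (f := fun p (j : Fin (m + 1)) => p.coeff j)
      ((Set.Finite.pi' fun _ => hS).subset ?_) ?_
    · rintro _ ⟨p, hp, rfl⟩ j
      exact hp.2 j
    · intro p hp r hr h
      ext j
      by_cases hj : j < m + 1
      · exact congrFun h ⟨j, hj⟩
      · rw [Polynomial.coeff_eq_zero_of_natDegree_lt (by have := hp.1; omega),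
          Polynomial.coeff_eq_zero_of_natDegree_lt (by have := hr.1; omega)]
  refine Set.Finite.of_finite_fibers (minpoly F) (hfin.subset ?_) ?_
  · rintro _ ⟨x, hx, rfl⟩
    exact hx
  · rintro _ ⟨x, -, rfl⟩
    refine ((minpoly F x).rootSet_finite N).subset ?_
    rintro y ⟨-, hy⟩
    rw [Polynomial.mem_rootSet]
    refine ⟨minpoly.ne_zero (Algebra.IsIntegral.isIntegral x), ?_⟩
    rw [← show minpoly F y = minpoly F x from hy, minpoly.aeval]

open Polynomial in
/-- In a global function field, a polynomial of degree at least `2` has only finitely many points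
with finite orbit. -/
theorem FunctionField.finite_setOf_finite_orbit {k N : Type*} [Field k] [Finite k] [Field N]
    [Algebra (RatFunc k) N] [FunctionField k N] {f : N[X]} (hf : 2 ≤ f.natDegree) :
    {x : N | (Set.range fun n : ℕ => (fun y => f.eval y)^[n] x).Finite}.Finite := by
  classical
  -- `k[X]` bounds the poles of the minimal polynomial's coefficients at the finite places, `O` at
  -- the infinite one.
  let O := (RatFunc.inftyValuation k).valuationSubring
  let _ : Algebra k[X] N :=
    ((algebraMap (RatFunc k) N).comp (algebraMap k[X] (RatFunc k))).toAlgebra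
  have : IsScalarTower k[X] (RatFunc k) N := .of_algebraMap_eq fun _ => rfl
  have : Algebra.IsAlgebraic k[X] N :=
    (IsFractionRing.comap_isAlgebraic_iff (K := RatFunc k)).2 inferInstance
  have : Algebra.IsAlgebraic O N :=
    (IsFractionRing.comap_isAlgebraic_iff (K := RatFunc k)).2 inferInstance
  have : FaithfulSMul k[X] N := .trans k[X] (RatFunc k) N
  have : FaithfulSMul O N := .trans O (RatFunc k) N
  obtain ⟨D₁, hD₁, h₁⟩ := exists_isIntegral_smul_of_finite_orbit k[X] hf
  obtain ⟨D₂, hD₂, h₂⟩ := exists_isIntegral_smul_of_finite_orbit O hf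
  have hne₁ : algebraMap k[X] (RatFunc k) D₁ ≠ 0 := by
    rwa [Ne, FaithfulSMul.algebraMap_eq_zero_iff]
  have hne₂ : algebraMap O (RatFunc k) D₂ ≠ 0 := by
    rwa [Ne, FaithfulSMul.algebraMap_eq_zero_iff]
  set m := Module.finrank (RatFunc k) N
  have hm (x : N) : (minpoly (RatFunc k) x).natDegree ≤ m := minpoly.natDegree_le x
  refine (minpoly.finite_of_coeff_mem
    (RatFunc.finite_setOf_mul_mem (pow_ne_zero m hne₁) (pow_ne_zero m hne₂)) m).subset
    fun x hx => ⟨hm x, fun j => ⟨?_, ?_⟩⟩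
  · exact minpoly.pow_mul_coeff_mem_range hD₁ (h₁ x hx) (hm x) j
  · obtain ⟨c, hc⟩ := minpoly.pow_mul_coeff_mem_range hD₂ (h₂ x hx) (hm x) j
    rw [← hc]
    exact c.2

/-! ### Linearized polynomials and separability -/

namespace TwistedPolynomial

variable {Fq E : Type*} [Field Fq] [Fintype Fq] [Field E] [Algebra Fq E]

open Polynomial in
/-- The `q`-linearized polynomial `∑ cᵢ X ^ (q ^ i)` attached to `∑ cᵢ τ ^ i`. -/
noncomputable def toPolynomial (f : TwistedPolynomial Fq E) : E[X] :=
  ∑ i ∈ f.support, C (f.coeff i) * X ^ Fintype.card Fq ^ i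

theorem aeval_toPolynomial (f : TwistedPolynomial Fq E) {L : Type*} [Field L] [Algebra Fq L]
    [Algebra E L] (u : L) : Polynomial.aeval u f.toPolynomial = toEnd L f u := by
  simp [toPolynomial, toEnd_apply]

theorem coeff_toPolynomial (f : TwistedPolynomial Fq E) (i : ℕ) :
    f.toPolynomial.coeff (Fintype.card Fq ^ i) = f.coeff i := by
  have h : ∀ j, Fintype.card Fq ^ i = Fintype.card Fq ^ j ↔ i = j :=
    fun j => (Nat.pow_right_injective (Fintype.one_lt_card (α := Fq))).eq_iff
  simp only [toPolynomial, Polynomial.finsetSum_coeff, Polynomial.coeff_C_mul_X_pow, h]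
  rw [Finset.sum_ite_eq, ite_eq_left_iff]
  intro hi
  rw [mem_support_iff, not_not] at hi
  exact hi.symm

/-- Since `q = 0` in `E`, only the term with `i = 0` survives differentiation. -/
theorem derivative_toPolynomial (f : TwistedPolynomial Fq E) :
    Polynomial.derivative f.toPolynomial = Polynomial.C (f.coeff 0) := by
  have hq : (Fintype.card Fq : E) = 0 := by
    rw [← map_natCast (algebraMap Fq E), FiniteField.cast_card_eq_zero, map_zero]
  rw [toPolynomial, Polynomial.derivative_sum, Finset.sum_eq_single 0]
  · simp
  · intro i _ hi
    rw [Polynomial.derivative_C_mul, Polynomial.derivative_X_pow, Nat.cast_pow, hq, zero_pow hi,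
      Polynomial.C_0, zero_mul, mul_zero]
  · intro h0
    rw [mem_support_iff, not_not] at h0
    simp [h0]

theorem map_toEnd (f : TwistedPolynomial Fq E) {L M : Type*} [Field L] [Algebra Fq L]
    [Algebra E L] [Field M] [Algebra Fq M] [Algebra E M] (σ : L →ₐ[E] M) (u : L) :
    σ (toEnd L f u) = toEnd M f (σ u) := by
  rw [← aeval_toPolynomial, ← aeval_toPolynomial, Polynomial.aeval_algHom_apply]

/-- `u` is a root of `f - e`, which is separable because its derivative is a nonzero constant. -/
theorem isSeparable_of_toEnd_eq {f : TwistedPolynomial Fq E} (hf : f.coeff 0 ≠ 0) {L : Type*}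
    [Field L] [Algebra Fq L] [Algebra E L] {u : L} {e : E} (h : toEnd L f u = algebraMap E L e) :
    IsSeparable E u := by
  have hsep : (f.toPolynomial - Polynomial.C e).Separable := by
    rw [Polynomial.separable_def, Polynomial.derivative_sub, Polynomial.derivative_C, sub_zero,
      derivative_toPolynomial]
    exact ⟨0, Polynomial.C (f.coeff 0)⁻¹, by
      rw [zero_mul, zero_add, ← Polynomial.C_mul, inv_mul_cancel₀ hf, Polynomial.C_1]⟩
  have hroot : Polynomial.aeval u (f.toPolynomial - Polynomial.C e) = 0 := by
    rw [map_sub, aeval_toPolynomial, h, Polynomial.aeval_C, sub_self]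
  exact hsep.of_dvd (minpoly.dvd E u hroot)

end TwistedPolynomial

/-! ### From torsion to finite orbits -/

-- `a ^ n • u` depends only on `X ^ n` modulo `P`, and `k[X]` has finitely many remainders modulo
-- `P`.
open Polynomial in
theorem Module.finite_range_pow_smul {k A M : Type*} [Field k] [Finite k] [CommRing A]
    [Algebra k A] [AddCommGroup M] [Module A M] (a : A) {P : k[X]} (hP : P ≠ 0) {u : M}
    (hu : aeval a P • u = 0) : (Set.range fun n : ℕ => a ^ n • u).Finite := by
  have : Finite (degreeLT k P.natDegree) :=
    Finite.of_equiv _ (degreeLTEquiv k _).symm.toEquiv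
  refine ((Set.toFinite (degreeLT k P.natDegree : Set k[X])).image
    fun r => aeval a r • u).subset ?_
  rintro _ ⟨n, rfl⟩
  refine ⟨X ^ n % P, ?_, ?_⟩
  · rw [SetLike.mem_coe, mem_degreeLT, ← degree_eq_natDegree hP]
    exact EuclideanDomain.mod_lt _ hP
  · have h := congrArg (fun r => aeval a r • u) (EuclideanDomain.mod_add_div (X ^ n) P)
    simp only [map_add, map_mul, map_pow, aeval_X, add_smul] at h
    rwa [mul_comm, mul_smul, hu, smul_zero, add_zero] at h

/-- `K` is algebraic over `k(a)`, so `m` is algebraic over `k[a]`; since `m` is not a zero divisor,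
it divides a nonzero constant term of an algebraic relation. This turns `m`-torsion into
`P(a)`-torsion. -/
theorem FunctionField.exists_ne_zero_dvd_aeval {k K : Type*} [Field k] [Field K] [Algebra k K]
    [Algebra (RatFunc k) K] [IsScalarTower k (RatFunc k) K] [FunctionField k K]
    {A : Subalgebra k K} {a : A} (ha : Transcendental k a) {m : A} (hm : m ≠ 0) :
    ∃ P : Polynomial k, P ≠ 0 ∧ m ∣ Polynomial.aeval a P := by
  have haK : Transcendental k (a : K) :=
    (transcendental_algebraMap_iff (A := K) Subtype.val_injective).2 ha
  have := FunctionField.finiteDimensional_of_adjoin_transcendental haK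
  have halg : IsAlgebraic (Algebra.adjoin k {(a : K)}) (A.val m) :=
    IntermediateField.isAlgebraic_adjoin_iff.1
      (Algebra.IsAlgebraic.isAlgebraic (R := IntermediateField.adjoin k {(a : K)}) (m : K))
  let f : Polynomial k →ₐ[k] Algebra.adjoin k {(a : K)} :=
    Polynomial.aeval ⟨(a : K), Algebra.self_mem_adjoin_singleton k (a : K)⟩
  have hfval : ∀ p, (f p : K) = Polynomial.aeval (a : K) p :=
    fun p => (Polynomial.aeval_algHom_apply (Subalgebra.val _) _ p).symm
  have hf : Function.Surjective f := by
    rintro ⟨x, hx⟩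
    rw [Algebra.adjoin_singleton_eq_range_aeval] at hx
    obtain ⟨p, hp⟩ := hx
    exact ⟨p, Subtype.ext ((hfval p).trans hp)⟩
  let _ : Algebra (Polynomial k) A := (Polynomial.aeval (R := k) a).toRingHom.toAlgebra
  have halg' : IsAlgebraic (Polynomial k) m := by
    refine halg.of_ringHom_of_comp_eq f A.val hf Subtype.val_injective (RingHom.ext fun p => ?_)
    exact (hfval p).trans (Polynomial.aeval_algHom_apply A.val a p)
  exact halg'.exists_nonzero_dvd (mem_nonZeroDivisors_of_ne_zero hm)

/-! ### Finiteness of torsion -/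

namespace DrinfeldModule

open TwistedPolynomial

section

variable {Fq A E : Type*} [Field Fq] [Fintype Fq] [CommRing A] [Algebra Fq A]
  [Field E] [Algebra Fq E] [Algebra A E]

theorem exists_two_le_natDegree (ρ : DrinfeldModule Fq A E) :
    ∃ a, 2 ≤ (ρ.toAlgHom a).toPolynomial.natDegree := by
  obtain ⟨a, ha⟩ := ρ.nontrivial
  refine ⟨a, ?_⟩
  obtain ⟨i, hi0, hi⟩ : ∃ i, i ≠ 0 ∧ (ρ.toAlgHom a).coeff i ≠ 0 := by
    by_contra! hcon
    refine ha (ext_coeff fun i => ?_)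
    rw [coeff_monomial]
    split_ifs with h
    · rw [← h, ρ.coeff_zero]
    · exact hcon i (Ne.symm h)
  calc 2 ≤ Fintype.card Fq := Fintype.one_lt_card
    _ ≤ Fintype.card Fq ^ i := Nat.le_self_pow hi0 _
    _ ≤ _ := Polynomial.le_natDegree_of_ne_zero (by rwa [coeff_toPolynomial])

variable (ρ : DrinfeldModule Fq A E) {N : Type*} [Field N] [Algebra Fq N] [Algebra E N]

theorem iterate_eval_toPolynomial (a : A) (u : N) (n : ℕ) :
    (fun y => ((ρ.toAlgHom a).toPolynomial.map (algebraMap E N)).eval y)^[n] u =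
      (Points.of ρ N).symm (a ^ n • Points.of ρ N u) := by
  induction n with
  | zero => simp
  | succ n ih =>
    rw [Function.iterate_succ_apply', ih, Polynomial.eval_map_algebraMap, aeval_toPolynomial,
      pow_succ', mul_smul]
    rfl

theorem finite_orbit_of_aeval_smul_eq_zero (a : A) {P : Polynomial Fq} (hP : P ≠ 0) {u : N}
    (hu : Polynomial.aeval a P • Points.of ρ N u = 0) :
    (Set.range fun n : ℕ => (fun y =>
      ((ρ.toAlgHom a).toPolynomial.map (algebraMap E N)).eval y)^[n] u).Finite := by
  simp only [iterate_eval_toPolynomial]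
  exact Set.range_comp (Points.of ρ N).symm (fun n : ℕ => a ^ n • Points.of ρ N u) ▸
    (Module.finite_range_pow_smul a hP hu).image _

end

theorem finite_setOf_finite_orbit {Fq K E : Type*} (N : Type*) [Field Fq] [Fintype Fq] [Field K]
    [Algebra Fq K] [Algebra (RatFunc Fq) K] [FunctionField Fq K] {A : Subalgebra Fq K} [Field E]
    [Algebra K E] [FiniteDimensional K E] [Algebra Fq E] [Field N] [Algebra E N]
    [FiniteDimensional E N] (ρ : DrinfeldModule Fq A E) {a : A}
    (ha : 2 ≤ (ρ.toAlgHom a).toPolynomial.natDegree) :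
    {u : N | (Set.range fun n : ℕ => (fun y =>
      ((ρ.toAlgHom a).toPolynomial.map (algebraMap E N)).eval y)^[n] u).Finite}.Finite := by
  let _ : Algebra (RatFunc Fq) E :=
    ((algebraMap K E).comp (algebraMap (RatFunc Fq) K)).toAlgebra
  have : IsScalarTower (RatFunc Fq) K E := .of_algebraMap_eq fun _ => rfl
  have : FiniteDimensional (RatFunc Fq) E := .trans (RatFunc Fq) K E
  let _ : Algebra (RatFunc Fq) N :=
    ((algebraMap E N).comp (algebraMap (RatFunc Fq) E)).toAlgebra
  have : IsScalarTower (RatFunc Fq) E N := .of_algebraMap_eq fun _ => rfl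
  have : FunctionField Fq N := FiniteDimensional.trans (RatFunc Fq) E N
  exact FunctionField.finite_setOf_finite_orbit (k := Fq) (by rwa [Polynomial.natDegree_map])

section

variable {Fq K E N : Type*} [Field Fq] [Fintype Fq] [Field K] [Algebra Fq K]
  [Algebra (RatFunc Fq) K] [FunctionField Fq K] {A : Subalgebra Fq K} [Field E] [Algebra K E]
  [FiniteDimensional K E] [Algebra Fq E] [Field N] [Algebra E N] [FiniteDimensional E N]
  [Algebra Fq N] (ρ : DrinfeldModule Fq A E)

/-- If `P(a) = 0` with `P ≠ 0`, every point of `E` has finite orbit under `ρ_a`; only finitely many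
points do, yet `E` is infinite. -/
theorem transcendental_of_two_le_natDegree {a : A}
    (ha : 2 ≤ (ρ.toAlgHom a).toPolynomial.natDegree) : Transcendental Fq a := by
  rintro ⟨P, hP, hPa⟩
  have hfin := ρ.finite_setOf_finite_orbit E ha
  have hall : Set.univ ⊆ {u : E | (Set.range fun n : ℕ => (fun y =>
      ((ρ.toAlgHom a).toPolynomial.map (algebraMap E E)).eval y)^[n] u).Finite} :=
    fun u _ => ρ.finite_orbit_of_aeval_smul_eq_zero a hP (by rw [hPa, zero_smul])
  have : Finite E := Set.finite_univ_iff.1 (hfin.subset hall)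
  have hinj := (algebraMap K E).injective.comp ((algebraMap (RatFunc Fq) K).injective.comp
    (RatFunc.algebraMap_injective Fq))
  exact Infinite.not_finite (Finite.of_injective _ hinj)

/-- A Drinfeld module of generic characteristic has only finitely many torsion points over a finite
extension. -/
theorem finite_setOf_torsion [IsScalarTower Fq (RatFunc Fq) K] :
    {u : N | ∃ m : A, m ≠ 0 ∧ m • Points.of ρ N u = 0}.Finite := by
  obtain ⟨a, ha⟩ := ρ.exists_two_le_natDegree
  refine (ρ.finite_setOf_finite_orbit N ha).subset ?_
  rintro u ⟨m, hm, hu⟩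
  obtain ⟨P, hP, c, hc⟩ := FunctionField.exists_ne_zero_dvd_aeval
    (ρ.transcendental_of_two_le_natDegree ha) hm
  refine ρ.finite_orbit_of_aeval_smul_eq_zero a hP ?_
  rw [hc, mul_comm, mul_smul, hu, smul_zero]

end

end DrinfeldModule

/-! ### Embeddings and the cogalois module -/

/-- The values `σ u` are all the roots of the minimal polynomial in `Ω`; by separability their
number is its degree, which is therefore `1`. -/
theorem IsSeparable.mem_range_of_algHom_eq {E L Ω : Type*} [Field E] [Field L] [Algebra E L]
    [Algebra.IsAlgebraic E L] [Field Ω] [Algebra E Ω] [IsAlgClosed Ω] {u : L}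
    (hu : IsSeparable E u) (h : ∀ σ τ : L →ₐ[E] Ω, σ u = τ u) : u ∈ (algebraMap E L).range := by
  classical
  have hr := Algebra.IsAlgebraic.range_eval_eq_rootSet_minpoly (F := E) Ω u
  have hsub : ((minpoly E u).rootSet Ω).Subsingleton := by
    rw [← hr]
    rintro _ ⟨σ, rfl⟩ _ ⟨τ, rfl⟩
    exact h σ τ
  rw [← minpoly.natDegree_eq_one_iff]
  refine le_antisymm ?_ (minpoly.natDegree_pos (Algebra.IsIntegral.isIntegral u))
  rw [← Polynomial.card_rootSet_eq_natDegree hu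
    (IsAlgClosed.splits ((minpoly E u).map (algebraMap E Ω)))]
  exact Fintype.card_le_one_iff_subsingleton.2 hsub.coe_sort

theorem mainTheorem6 {Fq K E L : Type*} [Field Fq] [Fintype Fq]
    -- `K` is a function field over `Fq`
    [Field K] [Algebra Fq K] [Algebra (RatFunc Fq) K] [IsScalarTower Fq (RatFunc Fq) K]
    [FunctionField Fq K]
    (Pinf : FunctionFieldPlace Fq K)
    -- `E / K` and `L / E` are finite extensions
    [Field E] [Algebra K E] [FiniteDimensional K E] [Algebra Fq E] [IsScalarTower Fq K E]
    [Field L] [Algebra E L] [FiniteDimensional E L] [Algebra Fq L] [IsScalarTower Fq E L]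
    (ρ : DrinfeldModule Fq Pinf.regularAway E) :
    Finite (ρ.CogaloisModule L) := by
  let Ω := AlgebraicClosure L
  let N := IntermediateField.normalClosure E L Ω
  have hN : {u : N | ∃ m : Pinf.regularAway, m ≠ 0 ∧
      m • DrinfeldModule.Points.of ρ N u = 0}.Finite := ρ.finite_setOf_torsion
  let T := ((↑) : N → Ω) '' {u : N | ∃ m : Pinf.regularAway, m ≠ 0 ∧
      m • DrinfeldModule.Points.of ρ N u = 0}
  have : Finite T := hN.image _
  have hmem : ∀ (u : ρ.drinT L) (σ τ : L →ₐ[E] Ω),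
      σ ((DrinfeldModule.Points.of ρ L).symm u) - τ ((DrinfeldModule.Points.of ρ L).symm u) ∈ T := by
    rintro ⟨u, m, hm, e, he⟩ σ τ
    have hσ (σ : L →ₐ[E] Ω) (u : L) : σ u ∈ N := σ.fieldRange_le_normalClosure ⟨u, rfl⟩
    have key (u : L) (hu : TwistedPolynomial.toEnd L (ρ.toAlgHom m) u = algebraMap E L e) :
        σ u - τ u ∈ T := by
      refine ⟨⟨σ u - τ u, sub_mem (hσ σ u) (hσ τ u)⟩, ⟨m, hm, ?_⟩, rfl⟩
      apply N.val.injective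
      refine (TwistedPolynomial.map_toEnd (ρ.toAlgHom m) N.val _).trans ?_
      change TwistedPolynomial.toEnd Ω (ρ.toAlgHom m) (σ u - τ u) = N.val 0
      rw [map_sub, ← TwistedPolynomial.map_toEnd, ← TwistedPolynomial.map_toEnd, hu,
        AlgHom.commutes, AlgHom.commutes, sub_self, map_zero]
    exact key u he.symm
  -- Chosen representatives suffice: only injectivity of `Φ` is needed, not additivity.
  let Φ : ρ.CogaloisModule L → (L →ₐ[E] Ω) × (L →ₐ[E] Ω) → T :=
    fun x p => ⟨_, hmem x.out p.1 p.2⟩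
  refine Finite.of_injective Φ fun x y hxy => ?_
  rw [← Quotient.out_eq x, ← Quotient.out_eq y]
  refine (Submodule.Quotient.eq _).2 ?_
  obtain ⟨m, hm, e, he⟩ := (x.out - y.out).2
  -- Generic characteristic enters here: the constant term is the image of `m` under the embedding
  -- of `A` into `E`.
  have hm0 : (ρ.toAlgHom m).coeff 0 ≠ 0 := by
    rw [ρ.coeff_zero]
    intro h
    exact hm (Subtype.ext ((algebraMap K E).injective (h.trans (map_zero _).symm)))
  have hsep := TwistedPolynomial.isSeparable_of_toEnd_eq hm0 (L := L) he.symm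
  obtain ⟨v, hv⟩ := hsep.mem_range_of_algHom_eq (Ω := Ω) fun σ τ => by
    have h : σ ((DrinfeldModule.Points.of ρ L).symm x.out) -
        τ ((DrinfeldModule.Points.of ρ L).symm x.out) =
        σ ((DrinfeldModule.Points.of ρ L).symm y.out) -
        τ ((DrinfeldModule.Points.of ρ L).symm y.out) :=
      congrArg Subtype.val (congrFun hxy (σ, τ))
    change σ ((DrinfeldModule.Points.of ρ L).symm x.out - (DrinfeldModule.Points.of ρ L).symm y.out)
      = τ ((DrinfeldModule.Points.of ρ L).symm x.out - (DrinfeldModule.Points.of ρ L).symm y.out)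
    rw [map_sub, map_sub, sub_eq_sub_iff_sub_eq_sub, h]
  exact ⟨v, hv⟩
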